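/- Let $G=(V,E)$ be a finite simple graph. Identify each triangle of $G$ with its edge set, and let $\mathscr T_G$ be the set of all triangles of $G$. A triangle cover of $G$ is a set of edges of $G$ that meets every triangle of $G$, and $\tau_t(G)$ is the minimum size of a triangle cover; $\nu_t(G)$ is the maximum number of pairwise edge-disjoint triangles of $G$. There is an algorithm with the following property. Let $c\in(0,1]$ be a real number such that $\mathscr T_G\neq\emptyset$ and $\nu_t(G)/|\mathscr T_G|\ge c$. Given the triangle hypergraph $(E,\mathscr T_G)$ of $G$, that is, the list of the triangles of $G$, in any order, each as the triple of (the names of) its edges, the algorithm finds in $O(|\mathscr T_G|^3)$ time on a unit-cost random access machine a triangle cover of $G$ of size at most $\frac{3c+1}{3c}\,\nu_t(G)$. Neither the algorithm nor the constant in the $O$ depends on $G$ or $c$. Consequently, $\tau_t(G)/\nu_t(G)\le\frac{3c+1}{3c}$ whenever $\mathscr T_G\ne\emptyset$, $c\in(0,1]$ and $\nu_t(G)/|\mathscr T_G|\ge c$. In particular, if $\mathscr T_G\ne\emptyset$ and $\nu_t(G)/|\mathscr T_G|\ge\frac13$, then $\tau_t(G)/\nu_t(G)\le2$. -/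

import Mathlib

universe u

namespace TriangleCover

/-! ## Triangles, triangle covers and triangle packings of a finite simple graph -/

section Graphs

variable {V : Type u} [Fintype V]

/-- `T` is the edge set of a triangle of `G`. -/
def IsTriangle (G : SimpleGraph V) (T : Finset (Sym2 V)) : Prop :=
  ∃ a b c : V, G.Adj a b ∧ G.Adj b c ∧ G.Adj a c ∧
    (T : Set (Sym2 V)) = {s(a, b), s(b, c), s(a, c)}

open Classical in
/-- The set of all triangles of `G`, each identified with its edge set. -/
noncomputable def triangles (G : SimpleGraph V) : Finset (Finset (Sym2 V)) :=
  Finset.univ.filter (IsTriangle G)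

/-- `C` is a set of edges of `G` that meets every triangle of `G`. -/
def IsTriangleCover (G : SimpleGraph V) (C : Finset (Sym2 V)) : Prop :=
  (C : Set (Sym2 V)) ⊆ G.edgeSet ∧ ∀ T ∈ triangles G, ∃ e ∈ T, e ∈ C

/-- `P` is a set of pairwise edge-disjoint triangles of `G`. -/
def IsTrianglePacking (G : SimpleGraph V) (P : Finset (Finset (Sym2 V))) : Prop :=
  P ⊆ triangles G ∧ ∀ S ∈ P, ∀ T ∈ P, S ≠ T → Disjoint S T

/-- The triangle covering number: the least size of a triangle cover
(all edges together form a triangle cover, so one exists). -/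
noncomputable def coveringNumber (G : SimpleGraph V) : ℕ :=
  sInf {k | ∃ C, IsTriangleCover G C ∧ C.card = k}

/-- The triangle packing number: the greatest size of a triangle packing
(the sizes are bounded by the number of triangles). -/
noncomputable def packingNumber (G : SimpleGraph V) : ℕ :=
  sSup {k | ∃ P, IsTrianglePacking G P ∧ P.card = k}

end Graphs

/-! ## The machine model

A random access machine, programmed in structured form. It has registers and random access
arrays, all of whose entries are natural numbers; a program mentions finitely many registers
and arrays. Every elementary instruction and every evaluation of a test costs one time unit.
The only arithmetic is `± 1`: in `t` steps numbers grow by at most `t` beyond the constants of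
the program and the initial entries, so that no work can be hidden in long numbers. -/

/-- A memory configuration: `reg x` is the content of register `x`, and `arr k i` is the
`i`-th entry of array `k`. -/
structure State where
  reg : ℕ → ℕ
  arr : ℕ → ℕ → ℕ

/-- Write `n` into register `x`. -/
def State.setReg (s : State) (x n : ℕ) : State :=
  { s with reg := Function.update s.reg x n }

/-- Write `n` into entry `i` of array `k`. -/
def State.setArr (s : State) (k i n : ℕ) : State :=
  { s with arr := Function.update s.arr k (Function.update (s.arr k) i n) }

/-- Comparisons of the contents of two registers. -/
inductive Test where
  | lt (x y : ℕ)
  | le (x y : ℕ)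
  | eq (x y : ℕ)
  | ne (x y : ℕ)

/-- The comparison succeeds in state `s`. -/
def Test.Holds (s : State) : Test → Prop
  | .lt x y => s.reg x < s.reg y
  | .le x y => s.reg x ≤ s.reg y
  | .eq x y => s.reg x = s.reg y
  | .ne x y => s.reg x ≠ s.reg y

/-- Programs. -/
inductive Prog where
  /-- do nothing -/
  | skip
  /-- register `x` gets the constant `n` -/
  | const (x n : ℕ)
  /-- register `x` gets the content of register `y` -/
  | copy (x y : ℕ)
  /-- register `x` is increased by one -/
  | inc (x : ℕ)
  /-- register `x` is decreased by one (zero stays zero) -/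
  | dec (x : ℕ)
  /-- register `x` gets the entry of array `k` whose index is the content of register `y` -/
  | load (x k y : ℕ)
  /-- the entry of array `k` whose index is the content of register `y` gets the content
  of register `x` -/
  | store (k y x : ℕ)
  /-- first `p`, then `q` -/
  | seq (p q : Prog)
  /-- `p` if the test succeeds, `q` otherwise -/
  | ite (b : Test) (p q : Prog)
  /-- repeat `p` as long as the test succeeds -/
  | loop (b : Test) (p : Prog)

/-- `Run p s t s'`: started in state `s`, the program `p` halts after exactly `t` time units,
and it halts in state `s'`. -/
inductive Run : Prog → State → ℕ → State → Prop
  | skip (s : State) : Run .skip s 1 s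
  | const (s : State) (x n : ℕ) : Run (.const x n) s 1 (s.setReg x n)
  | copy (s : State) (x y : ℕ) : Run (.copy x y) s 1 (s.setReg x (s.reg y))
  | inc (s : State) (x : ℕ) : Run (.inc x) s 1 (s.setReg x (s.reg x + 1))
  | dec (s : State) (x : ℕ) : Run (.dec x) s 1 (s.setReg x (s.reg x - 1))
  | load (s : State) (x k y : ℕ) : Run (.load x k y) s 1 (s.setReg x (s.arr k (s.reg y)))
  | store (s : State) (k y x : ℕ) :
      Run (.store k y x) s 1 (s.setArr k (s.reg y) (s.reg x))
  | seq {p q : Prog} {s s₁ s₂ : State} {t₁ t₂ : ℕ} :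
      Run p s t₁ s₁ → Run q s₁ t₂ s₂ → Run (.seq p q) s (t₁ + t₂) s₂
  | ite_true {b : Test} {p q : Prog} {s s₁ : State} {t : ℕ} :
      b.Holds s → Run p s t s₁ → Run (.ite b p q) s (t + 1) s₁
  | ite_false {b : Test} {p q : Prog} {s s₁ : State} {t : ℕ} :
      ¬ b.Holds s → Run q s t s₁ → Run (.ite b p q) s (t + 1) s₁
  | loop_true {b : Test} {p : Prog} {s s₁ s₂ : State} {t₁ t₂ : ℕ} :
      b.Holds s → Run p s t₁ s₁ → Run (.loop b p) s₁ t₂ s₂ →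
        Run (.loop b p) s (t₁ + t₂ + 1) s₂
  | loop_false {b : Test} {p : Prog} {s : State} :
      ¬ b.Holds s → Run (.loop b p) s 1 s

/-! ## Input and output

The input is the triangle hypergraph of `G`: the list of the triangles of `G`, in any order,
each given by its three edges, in any order. The edges are represented by natural numbers,
different edges by different ones. -/

section InputOutput

variable {V : Type u} [Fintype V]

/-- A list of all triangles of `G`, without repetition, each given by its three edges. -/
structure TriangleListing (G : SimpleGraph V) where
  tri : Fin (triangles G).card ≃ {T : Finset (Sym2 V) // T ∈ triangles G}
  edge : Fin (triangles G).card → Fin 3 → Sym2 V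
  range_edge : ∀ i, Set.range (edge i) = ((tri i : Finset (Sym2 V)) : Set (Sym2 V))

/-- The initial state: register `0` holds the number of triangles, arrays `0`, `1`, `2` hold
at index `i` the names of the three edges of the `i`-th triangle; all else is zero. -/
noncomputable def inputState {G : SimpleGraph V} (name : Sym2 V → ℕ) (L : TriangleListing G) :
    State where
  reg x := if x = 0 then (triangles G).card else 0
  arr k i :=
    if h : i < (triangles G).card ∧ k < 3 then name (L.edge ⟨i, h.1⟩ ⟨k, h.2⟩) else 0

/-- The state holds the edge set `C` as output: register `0` holds the size of `C`, and that
many first entries of array `0` are the names of the elements of `C`. -/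
def HoldsOutput (name : Sym2 V → ℕ) (C : Finset (Sym2 V)) (s : State) : Prop :=
  s.reg 0 = C.card ∧ (Finset.range C.card).image (s.arr 0) = C.image name

end InputOutput

end TriangleCover

/-!
The algorithm is greedy, in three passes over the edges, with thresholds `d = 3, 2, 1`: an edge is
selected if it lies in at least `d` triangles that are not yet covered, and these triangles are then
covered. The numbers of uncovered triangles at the edges never grow, so after the pass with
threshold `d` every edge lies in fewer than `d` uncovered triangles, and the last pass leaves none.
One test costs `O(m)` for `m` triangles, the whole run `O(m²)`.

The cover has at most `m / 3 + ν` edges, and `m ≤ ν / c` turns this into `(3 c + 1) / (3 c) ν`. An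
edge selected at threshold `3` is charged to three triangles. In the conflict graph of the
set `W` of the remaining triangles (adjacent when they share an edge) the degrees are at most three,
the pass with threshold `2` picks a maximal matching, with `b` edges say, and the last pass takes one
edge for each of the `u` unmatched vertices, which form an independent set. So `b + u` edges are
selected, `|W| = 2 b + u`, and with `α` the independence number it suffices that `b + 2 u ≤ 3 α`
(`exists_isIndepSet_of_even`). This is shown for each component separately. If `b ≤ u`, it
follows from `u ≤ α`. If `b ≥ u + 1`, it follows from `3 α ≥ |W| - 1`, which holds for connected
graphs of maximum degree three (`exists_isIndepSet_of_connected`): after removal of one closed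
neighbourhood the rest is 2-degenerate.

The program is verified in a Hoare-style calculus with time bounds (`Halts`); its memory represents
the pair of sets on which the mathematical version `greedyCover` of the algorithm works. The bounds
on the covering number follow from the cover that the program finds.
-/

namespace TriangleCover

open Finset

/-! ### Independent sets in graphs of maximum degree three -/

section Independent

open Classical

variable {α : Type*} [DecidableEq α] (G : SimpleGraph α)

theorem exists_isIndepSet_insert {S I : Finset α} {v : α} {k : ℕ} (hv : v ∈ S)
    (hk : #{w ∈ S | G.Adj v w} ≤ k) (hI : I ⊆ {w ∈ S | w ≠ v ∧ ¬ G.Adj v w})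
    (hind : G.IsIndepSet (I : Set α)) :
    insert v I ⊆ S ∧ G.IsIndepSet (insert v I : Finset α) ∧ #(insert v I) = #I + 1 ∧
      #S ≤ #{w ∈ S | w ≠ v ∧ ¬ G.Adj v w} + k + 1 := by
  refine ⟨?_, ?_, ?_, ?_⟩
  · exact insert_subset hv (hI.trans (filter_subset _ _))
  · rw [coe_insert]
    have hsymm : Std.Symm fun a b => ¬ G.Adj a b := ⟨fun a b h h' => h h'.symm⟩
    exact Set.pairwise_insert_of_symm.2
      ⟨hind, fun b hb _ => (mem_filter.1 (hI hb)).2.2⟩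
  · refine card_insert_of_notMem fun h => ?_
    exact (mem_filter.1 (hI h)).2.1 rfl
  · have hsub : S ⊆ insert v ({w ∈ S | w ≠ v ∧ ¬ G.Adj v w} ∪ {w ∈ S | G.Adj v w}) := by
      intro w hw
      simp only [mem_insert, mem_union, mem_filter]
      tauto
    have h1 := card_le_card hsub
    have h2 := card_insert_le v ({w ∈ S | w ≠ v ∧ ¬ G.Adj v w} ∪ {w ∈ S | G.Adj v w})
    have h3 := card_union_le {w ∈ S | w ≠ v ∧ ¬ G.Adj v w} {w ∈ S | G.Adj v w}
    omega

/-- A 2-degenerate graph has an independent set containing a third of the vertices: pick a vertex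
with at most two neighbours, discard these, and repeat. -/
theorem exists_isIndepSet_of_degenerate (S : Finset α)
    (h : ∀ S' ⊆ S, S'.Nonempty → ∃ v ∈ S', #{w ∈ S' | G.Adj v w} ≤ 2) :
    ∃ I ⊆ S, G.IsIndepSet (I : Set α) ∧ #S ≤ 3 * #I := by
  induction S using Finset.strongInduction with
  | H S ih =>
    rcases S.eq_empty_or_nonempty with rfl | hne
    · exact ⟨∅, by simp, by simp [SimpleGraph.IsIndepSet], by simp⟩
    obtain ⟨v, hv, hdeg⟩ := h S subset_rfl hne
    have hss : {w ∈ S | w ≠ v ∧ ¬ G.Adj v w} ⊂ S :=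
      filter_ssubset.2 ⟨v, hv, by simp⟩
    obtain ⟨I, hI, hind, hcard⟩ := ih _ hss fun S' hS' => h S' (hS'.trans hss.subset)
    obtain ⟨h1, h2, h3, h4⟩ := exists_isIndepSet_insert G hv hdeg hI hind
    exact ⟨insert v I, h1, h2, by omega⟩

/-- In a connected graph of maximum degree three, every nonempty proper set of vertices has a
vertex with a neighbour outside, so that removing one closed neighbourhood leaves a 2-degenerate
graph. This loses only `1` against the bound of Brooks' theorem, and holds for `K₄` too. -/
theorem exists_isIndepSet_of_connected {W : Finset α} (hW : W.Nonempty)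
    (hdeg : ∀ v ∈ W, #{w ∈ W | G.Adj v w} ≤ 3)
    (hconn : ∀ K ⊆ W, K.Nonempty → (∀ a ∈ K, ∀ b ∈ W, G.Adj a b → b ∈ K) → K = W) :
    ∃ I ⊆ W, G.IsIndepSet (I : Set α) ∧ #W ≤ 3 * #I + 1 := by
  obtain ⟨v, hv⟩ := hW
  obtain ⟨I, hI, hind, hcard⟩ :=
    exists_isIndepSet_of_degenerate G {w ∈ W | w ≠ v ∧ ¬ G.Adj v w} (by
      intro S hS hne
      have hSW : S ⊆ W := hS.trans (filter_subset _ _)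
      have hvS : v ∉ S := fun h => (mem_filter.1 (hS h)).2.1 rfl
      have hSne : S ≠ W := fun h => hvS (h ▸ hv)
      have hopen := mt (hconn S hSW hne) hSne
      push Not at hopen
      obtain ⟨a, ha, b, hb, hab, hbS⟩ := hopen
      refine ⟨a, ha, ?_⟩
      have hlt : {w ∈ S | G.Adj a w} ⊂ {w ∈ W | G.Adj a w} :=
        ssubset_iff_of_subset (filter_subset_filter _ hSW) |>.2
          ⟨b, by simp [hb, hab], by simp [hbS]⟩
      have := card_lt_card hlt
      have := hdeg a (hSW ha)
      omega)
  obtain ⟨h1, h2, h3, h4⟩ := exists_isIndepSet_insert G hv (hdeg v hv) hI hind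
  exact ⟨insert v I, h1, h2, by omega⟩

/-- The inequality behind the approximation guarantee. It is used with `U` the set of vertices
missed by a maximal matching of `W`: then `U` is independent, and the matched vertices of every
union of components are even in number. On a component, either `U` itself is large
enough, or parity makes up for the `1` lost in `exists_isIndepSet_of_connected`. -/
theorem exists_isIndepSet_of_even {W U : Finset α} (hUW : U ⊆ W)
    (hU : G.IsIndepSet (U : Set α)) (hdeg : ∀ v ∈ W, #{w ∈ W | G.Adj v w} ≤ 3)
    (heven : ∀ K ⊆ W, (∀ a ∈ K, ∀ b ∈ W, G.Adj a b → b ∈ K) → Even #(K \ U)) :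
    ∃ I ⊆ W, G.IsIndepSet (I : Set α) ∧ #W + 3 * #U ≤ 6 * #I := by
  induction W using Finset.strongInduction generalizing U with
  | H W ih =>
    rcases W.eq_empty_or_nonempty with rfl | hne
    · exact ⟨∅, by simp, by simp [SimpleGraph.IsIndepSet], by simp [subset_empty.1 hUW]⟩
    by_cases hconn : ∀ K ⊆ W, K.Nonempty → (∀ a ∈ K, ∀ b ∈ W, G.Adj a b → b ∈ K) → K = W
    · obtain ⟨I, hI, hind, hcard⟩ := exists_isIndepSet_of_connected G hne hdeg hconn
      obtain ⟨r, hr⟩ := heven W subset_rfl fun _ _ b hb _ => hb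
      have hsum := card_sdiff_add_card_eq_card hUW
      -- `#(W \ U) = 2 r`: if `r ≤ #U` then `U` will do, otherwise even `r ≥ #U + 1`
      by_cases hle : r ≤ #U
      · exact ⟨U, hUW, hU, by omega⟩
      · exact ⟨I, hI, hind, by omega⟩
    · push Not at hconn
      obtain ⟨K, hKW, hKne, hK, hKneW⟩ := hconn
      have hK' : ∀ a ∈ W \ K, ∀ b ∈ W, G.Adj a b → b ∈ W \ K := by
        intro a ha b hb hab
        rw [mem_sdiff] at ha ⊢
        exact ⟨hb, fun hbK => ha.2 (hK b hbK a ha.1 hab.symm)⟩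
      have key : ∀ X ⊂ W, (∀ a ∈ X, ∀ b ∈ W, G.Adj a b → b ∈ X) →
          ∃ I ⊆ X, G.IsIndepSet (I : Set α) ∧ #X + 3 * #(X ∩ U) ≤ 6 * #I := by
        intro X hX hcl
        refine ih X hX inter_subset_left (hU.mono (by simp)) ?_ ?_
        · exact fun v hv => (card_le_card (filter_subset_filter _ hX.subset)).trans
            (hdeg v (hX.subset hv))
        · intro Y hY hYcl
          have : Y \ (X ∩ U) = Y \ U := by
            ext y
            simp only [mem_sdiff, mem_inter]
            have := @hY y
            tauto
          rw [this]
          exact heven Y (hY.trans hX.subset) fun a ha b hb hab =>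
            hYcl a ha b (hcl a (hY ha) b hb hab) hab
      obtain ⟨I, hI, hIind, hIcard⟩ := key K (hKW.ssubset_of_ne hKneW) hK
      obtain ⟨J, hJ, hJind, hJcard⟩ := key (W \ K) (sdiff_ssubset hKW hKne) hK'
      have hdisj : Disjoint I J := disjoint_of_subset_left hI
        (disjoint_of_subset_right hJ disjoint_sdiff)
      refine ⟨I ∪ J, union_subset (hI.trans hKW) (hJ.trans sdiff_subset), ?_, ?_⟩
      · intro a ha b hb hab hadj
        simp only [coe_union, Set.mem_union, mem_coe] at ha hb
        rcases ha with ha | ha <;> rcases hb with hb | hb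
        · exact hIind ha hb hab hadj
        · exact (mem_sdiff.1 (hJ hb)).2
            (hK a (hI ha) b (mem_sdiff.1 (hJ hb)).1 hadj)
        · exact (mem_sdiff.1 (hJ ha)).2
            (hK b (hI hb) a (mem_sdiff.1 (hJ ha)).1 hadj.symm)
        · exact hJind ha hb hab hadj
      · have h1 := card_sdiff_add_card_eq_card hKW
        have h2 : #U ≤ #(K ∩ U) + #((W \ K) ∩ U) := by
          refine (card_le_card fun u hu => ?_).trans (card_union_le _ _)
          have := hUW hu
          simp only [mem_union, mem_inter, mem_sdiff]
          tauto
        rw [card_union_of_disjoint hdisj]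
        omega

end Independent

/-! ### The greedy algorithm -/

section Greedy

/-- The hypergraph is given by a table: `E 0 i`, `E 1 i`, `E 2 i` are the three points of the
`i`-th triple. `InTriple E x i` says that `x` is one of them. -/
abbrev InTriple (E : ℕ → ℕ → ℕ) (x i : ℕ) : Prop :=
  E 0 i = x ∨ E 1 i = x ∨ E 2 i = x

/-- One greedy step on a pair `(A, C)`, with `A` the set of the triples not yet covered and `C` the
set of the points selected so far: select `x` if it covers at least `d` triples of `A`. -/
def greedyStep (E : ℕ → ℕ → ℕ) (d x : ℕ) (S : Finset ℕ × Finset ℕ) : Finset ℕ × Finset ℕ :=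
  if d ≤ #{i ∈ S.1 | InTriple E x i} then
    ({i ∈ S.1 | ¬ InTriple E x i}, insert x S.2)
  else S

/-- Try the points of the first `n` triples one after the other. -/
def greedyPass (E : ℕ → ℕ → ℕ) (d : ℕ) : ℕ → Finset ℕ × Finset ℕ → Finset ℕ × Finset ℕ
  | 0, S => S
  | n + 1, S => greedyStep E d (E 2 n) (greedyStep E d (E 1 n)
      (greedyStep E d (E 0 n) (greedyPass E d n S)))

variable {E : ℕ → ℕ → ℕ} {d m : ℕ}

theorem greedyPass_induction {J : Finset ℕ × Finset ℕ → Prop}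
    (hJ : ∀ x S, J S → J (greedyStep E d x S)) (n : ℕ) {S : Finset ℕ × Finset ℕ} (hS : J S) :
    J (greedyPass E d n S) := by
  induction n with
  | zero => exact hS
  | succ n ih => exact hJ _ _ (hJ _ _ (hJ _ _ ih))

theorem greedyStep_fst_subset (x : ℕ) (S : Finset ℕ × Finset ℕ) :
    (greedyStep E d x S).1 ⊆ S.1 := by
  unfold greedyStep
  split_ifs
  · exact filter_subset _ _
  · exact subset_rfl

theorem greedyPass_fst_subset (n : ℕ) (S : Finset ℕ × Finset ℕ) :
    (greedyPass E d n S).1 ⊆ S.1 :=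
  greedyPass_induction (J := fun S' => S'.1 ⊆ S.1)
    (fun x S' h => (greedyStep_fst_subset x S').trans h) n subset_rfl

theorem card_filter_greedyStep_lt (hd : 0 < d) (x : ℕ) (S : Finset ℕ × Finset ℕ) :
    #{i ∈ (greedyStep E d x S).1 | InTriple E x i} < d := by
  unfold greedyStep
  split_ifs with h
  · rw [filter_filter, filter_false_of_mem]
    · simpa using hd
    · exact fun i _ h => h.1 h.2
  · omega

theorem card_filter_greedyPass_lt_of_inTriple (hd : 0 < d) (S : Finset ℕ × Finset ℕ)
    {n i x : ℕ} (hi : i < n) (hx : InTriple E x i) :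
    #{j ∈ (greedyPass E d n S).1 | InTriple E x j} < d := by
  have mono : ∀ y (S' : Finset ℕ × Finset ℕ), #{j ∈ S'.1 | InTriple E x j} < d →
      #{j ∈ (greedyStep E d y S').1 | InTriple E x j} < d := fun y S' h =>
    (card_le_card (filter_subset_filter _ (greedyStep_fst_subset y S'))).trans_lt h
  induction n with
  | zero => omega
  | succ n ih =>
    rcases Nat.lt_succ_iff_lt_or_eq.1 hi with hi | rfl
    · exact mono _ _ (mono _ _ (mono _ _ (ih hi)))
    · rcases hx with rfl | rfl | rfl
      · exact mono _ _ (mono _ _ (card_filter_greedyStep_lt hd _ _))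
      · exact mono _ _ (card_filter_greedyStep_lt hd _ _)
      · exact card_filter_greedyStep_lt hd _ _

/-- After a pass with threshold `d`, every point lies in fewer than `d` uncovered triples. One pass
is enough, because these numbers never grow. -/
theorem card_filter_greedyPass_lt (hd : 0 < d) {S : Finset ℕ × Finset ℕ}
    (hS : S.1 ⊆ range m) (x : ℕ) :
    #{j ∈ (greedyPass E d m S).1 | InTriple E x j} < d := by
  rcases ({j ∈ (greedyPass E d m S).1 | InTriple E x j}).eq_empty_or_nonempty with h | ⟨i, hi⟩
  · simpa [h] using hd
  · rw [mem_filter] at hi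
    exact card_filter_greedyPass_lt_of_inTriple hd S
      (mem_range.1 (hS (greedyPass_fst_subset _ _ hi.1))) hi.2

theorem greedyPass_weight (n : ℕ) (S : Finset ℕ × Finset ℕ) :
    d * #(greedyPass E d n S).2 + #(greedyPass E d n S).1 ≤ d * #S.2 + #S.1 := by
  refine greedyPass_induction
    (J := fun S' => d * #S'.2 + #S'.1 ≤ d * #S.2 + #S.1) (fun x S' h => ?_) n le_rfl
  refine le_trans ?_ h
  unfold greedyStep
  split_ifs with hle
  · have h1 := card_filter_add_card_filter_not (s := S'.1) (fun i => InTriple E x i)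
    have h2 := Nat.mul_le_mul_left d (card_insert_le x S'.2)
    rw [Nat.mul_succ] at h2
    dsimp only
    omega
  · exact le_rfl

/-- The pair `(A, C)` is a partial solution for the first `m` triples. -/
structure IsPartialCover (E : ℕ → ℕ → ℕ) (m : ℕ) (S : Finset ℕ × Finset ℕ) : Prop where
  subset : S.1 ⊆ range m
  covered : ∀ i < m, i ∉ S.1 → ∃ x ∈ S.2, InTriple E x i
  fresh : ∀ x ∈ S.2, ∀ i ∈ S.1, ¬ InTriple E x i
  exists_inTriple : ∀ x ∈ S.2, ∃ i < m, InTriple E x i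

theorem isPartialCover_init : IsPartialCover E m (range m, ∅) :=
  ⟨subset_rfl, fun i hi h => absurd (mem_range.2 hi) h, by simp, by simp⟩

theorem IsPartialCover.greedyStep {S : Finset ℕ × Finset ℕ} (hS : IsPartialCover E m S)
    (hd : 0 < d) (x : ℕ) : IsPartialCover E m (greedyStep E d x S) := by
  unfold TriangleCover.greedyStep
  split_ifs with h
  · obtain ⟨i, hi⟩ := card_pos.1 (hd.trans_le h)
    rw [mem_filter] at hi
    refine ⟨(filter_subset _ _).trans hS.subset, fun j hj hjS => ?_, fun y hy j hj => ?_,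
      fun y hy => ?_⟩
    · by_cases hjA : j ∈ S.1
      · have : InTriple E x j := by
          by_contra hn
          exact hjS (mem_filter.2 ⟨hjA, hn⟩)
        exact ⟨x, mem_insert_self _ _, this⟩
      · obtain ⟨y, hy, hyj⟩ := hS.covered j hj hjA
        exact ⟨y, mem_insert_of_mem hy, hyj⟩
    · rw [mem_filter] at hj
      rcases mem_insert.1 hy with rfl | hy
      · exact hj.2
      · exact hS.fresh y hy j hj.1
    · rcases mem_insert.1 hy with rfl | hy
      · exact ⟨i, mem_range.1 (hS.subset hi.1), hi.2⟩
      · exact hS.exists_inTriple y hy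
  · exact hS

theorem IsPartialCover.greedyPass {S : Finset ℕ × Finset ℕ} (hS : IsPartialCover E m S)
    (hd : 0 < d) (n : ℕ) : IsPartialCover E m (greedyPass E d n S) :=
  greedyPass_induction (fun x _ h => h.greedyStep hd x) n hS

/-- The conflict graph: two different triples are adjacent if they have a common point. -/
def conflictGraph (E : ℕ → ℕ → ℕ) : SimpleGraph ℕ where
  Adj i j := i ≠ j ∧ ∃ x, InTriple E x i ∧ InTriple E x j
  symm := ⟨fun _ _ h => ⟨h.1.symm, h.2.imp fun _ hx => hx.symm⟩⟩
  loopless := ⟨fun _ h => h.1 rfl⟩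

open Classical in
theorem conflictGraph_degree_le {A : Finset ℕ}
    (hA : ∀ x, #{j ∈ A | InTriple E x j} < 3) {i : ℕ} (hi : i ∈ A) :
    #{j ∈ A | (conflictGraph E).Adj i j} ≤ 3 := by
  have hone : ∀ k, InTriple E (E k i) i → #{j ∈ A.erase i | InTriple E (E k i) j} ≤ 1 := by
    intro k hk
    have hlt : {j ∈ A.erase i | InTriple E (E k i) j} ⊂ {j ∈ A | InTriple E (E k i) j} :=
      ssubset_iff_of_subset (filter_subset_filter _ (erase_subset _ _)) |>.2
        ⟨i, mem_filter.2 ⟨hi, hk⟩, by simp⟩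
    have := card_lt_card hlt
    have := hA (E k i)
    omega
  have hsub : {j ∈ A | (conflictGraph E).Adj i j} ⊆
      {j ∈ A.erase i | InTriple E (E 0 i) j} ∪ ({j ∈ A.erase i | InTriple E (E 1 i) j} ∪
        {j ∈ A.erase i | InTriple E (E 2 i) j}) := by
    intro j hj
    obtain ⟨hjA, hne, x, hxi, hxj⟩ := mem_filter.1 hj
    have hjA' : j ∈ A.erase i := mem_erase.2 ⟨hne.symm, hjA⟩
    rcases hxi with rfl | rfl | rfl
    · exact mem_union_left _ (mem_filter.2 ⟨hjA', hxj⟩)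
    · exact mem_union_right _ (mem_union_left _ (mem_filter.2 ⟨hjA', hxj⟩))
    · exact mem_union_right _ (mem_union_right _ (mem_filter.2 ⟨hjA', hxj⟩))
  have h1 := (card_le_card hsub).trans (card_union_le _ _)
  have h2 := card_union_le {j ∈ A.erase i | InTriple E (E 1 i) j}
    {j ∈ A.erase i | InTriple E (E 2 i) j}
  have := hone 0 (Or.inl rfl)
  have := hone 1 (Or.inr (Or.inl rfl))
  have := hone 2 (Or.inr (Or.inr rfl))
  omega

theorem conflictGraph_isIndepSet {A : Finset ℕ} (hA : ∀ x, #{j ∈ A | InTriple E x j} < 2) :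
    (conflictGraph E).IsIndepSet (A : Set ℕ) := by
  rintro i hi j hj hij ⟨_, x, hxi, hxj⟩
  have : 1 < #{j ∈ A | InTriple E x j} :=
    one_lt_card.2 ⟨i, mem_filter.2 ⟨hi, hxi⟩, j, mem_filter.2 ⟨hj, hxj⟩, hij⟩
  have := hA x
  omega

/-- While no point lies in three uncovered triples, a step with threshold `2` covers the two ends
of an edge of the conflict graph, which lie in the same component. -/
theorem even_card_sdiff_greedyPass {S : Finset ℕ × Finset ℕ}
    (hS : ∀ x, #{j ∈ S.1 | InTriple E x j} < 3) {K : Finset ℕ} (hKS : K ⊆ S.1)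
    (hK : ∀ a ∈ K, ∀ b ∈ S.1, (conflictGraph E).Adj a b → b ∈ K) (n : ℕ) :
    Even #(K \ (greedyPass E 2 n S).1) := by
  suffices h : (greedyPass E 2 n S).1 ⊆ S.1 ∧ Even #(K \ (greedyPass E 2 n S).1) from h.2
  refine greedyPass_induction (J := fun S' => S'.1 ⊆ S.1 ∧ Even #(K \ S'.1)) ?_ n
    ⟨subset_rfl, by simp [sdiff_eq_empty_iff_subset.2 hKS]⟩
  rintro x S' ⟨hsub, heven⟩
  refine ⟨(greedyStep_fst_subset x S').trans hsub, ?_⟩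
  unfold greedyStep
  split_ifs with hle
  · have htwo : #{i ∈ S'.1 | InTriple E x i} = 2 := by
      have := (card_le_card (filter_subset_filter (fun i => InTriple E x i) hsub)).trans_lt (hS x)
      omega
    have hsplit : K \ {i ∈ S'.1 | ¬ InTriple E x i} =
        (K \ S'.1) ∪ (K ∩ {i ∈ S'.1 | InTriple E x i}) := by
      ext i
      simp only [mem_sdiff, mem_union, mem_inter, mem_filter]
      tauto
    have hdisj : Disjoint (K \ S'.1) (K ∩ {i ∈ S'.1 | InTriple E x i}) := by
      rw [disjoint_left]
      intro i hi hi'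
      exact (mem_sdiff.1 hi).2 (mem_filter.1 (mem_inter.1 hi').2).1
    dsimp only
    rw [hsplit, card_union_of_disjoint hdisj]
    refine heven.add ?_
    rcases (K ∩ {i ∈ S'.1 | InTriple E x i}).eq_empty_or_nonempty with h0 | ⟨a, ha⟩
    · simp [h0]
    · rw [mem_inter, mem_filter] at ha
      rw [inter_eq_right.2, htwo]
      · exact even_two
      · intro b hb
        rw [mem_filter] at hb
        by_cases hab : a = b
        · exact hab ▸ ha.1
        · exact hK a ha.1 b (hsub hb.1) ⟨hab, x, ha.2.2, hb.2⟩
  · exact heven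

/-- The result of the passes with thresholds `3`, `2` and `1`. -/
def greedyCover (E : ℕ → ℕ → ℕ) (m : ℕ) : Finset ℕ × Finset ℕ :=
  greedyPass E 1 m (greedyPass E 2 m (greedyPass E 3 m (range m, ∅)))

theorem greedyCover_isPartialCover : IsPartialCover E m (greedyCover E m) :=
  ((isPartialCover_init.greedyPass (by simp) m).greedyPass (by simp) m).greedyPass (by simp) m

theorem greedyCover_covers {i : ℕ} (hi : i < m) : ∃ x ∈ (greedyCover E m).2, InTriple E x i := by
  refine greedyCover_isPartialCover.covered i hi fun h => ?_
  have hsub : (greedyPass E 2 m (greedyPass E 3 m (range m, ∅))).1 ⊆ range m :=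
    (greedyPass_fst_subset _ _).trans (greedyPass_fst_subset _ _)
  have h0 := card_filter_greedyPass_lt (E := E) one_pos hsub (E 0 i)
  rw [Nat.lt_one_iff, card_eq_zero] at h0
  have : i ∈ ({j ∈ (greedyCover E m).1 | InTriple E (E 0 i) j} : Finset ℕ) :=
    mem_filter.2 ⟨h, Or.inl rfl⟩
  rw [greedyCover, h0] at this
  simp at this

theorem card_greedyCover_le : #(greedyCover E m).2 ≤ m := by
  have h1 := greedyPass_weight (E := E) (d := 1) m (greedyPass E 2 m (greedyPass E 3 m (range m, ∅)))
  have h2 := greedyPass_weight (E := E) (d := 2) m (greedyPass E 3 m (range m, ∅))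
  have h3 := greedyPass_weight (E := E) (d := 3) m (range m, ∅)
  simp only [card_range, card_empty] at h3
  rw [greedyCover]
  omega

/-- The greedy cover has at most `m / 3 + ν` points. The points selected at threshold `3` are paid
for by the triples that they cover, the others by `exists_isIndepSet_of_even`. -/
theorem exists_isIndepSet_greedyCover :
    ∃ I ⊆ range m, (conflictGraph E).IsIndepSet (I : Set ℕ) ∧
      3 * #(greedyCover E m).2 ≤ m + 3 * #I := by
  set S₁ := greedyPass E 3 m (range m, ∅) with hS₁
  have hsub : S₁.1 ⊆ range m := greedyPass_fst_subset _ _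
  have hthree : ∀ x, #{j ∈ S₁.1 | InTriple E x j} < 3 :=
    card_filter_greedyPass_lt (by simp) subset_rfl
  obtain ⟨I, hI, hind, hcard⟩ := exists_isIndepSet_of_even (conflictGraph E)
    (greedyPass_fst_subset (E := E) (d := 2) m S₁)
    (conflictGraph_isIndepSet (card_filter_greedyPass_lt two_pos hsub))
    (fun i hi => conflictGraph_degree_le hthree hi)
    (fun K hKS hK => even_card_sdiff_greedyPass hthree hKS hK m)
  refine ⟨I, hI.trans hsub, hind, ?_⟩
  have h1 := greedyPass_weight (E := E) (d := 1) m (greedyPass E 2 m S₁)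
  have h2 := greedyPass_weight (E := E) (d := 2) m S₁
  have h3 := greedyPass_weight (E := E) (d := 3) m (range m, ∅)
  simp only [card_range, card_empty] at h3
  rw [← hS₁] at h3
  rw [greedyCover, ← hS₁]
  omega

end Greedy

/-! ### Reasoning about programs -/

section Machine

/-- Total correctness with a time bound: started in `s`, the program `p` halts after at most `T`
time units, in a state that satisfies `Q`. -/
def Halts (p : Prog) (s : State) (T : ℕ) (Q : State → Prop) : Prop :=
  ∃ t s', Run p s t s' ∧ t ≤ T ∧ Q s'

variable {p q : Prog} {s : State} {T T₁ T₂ : ℕ} {Q Q' : State → Prop}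

theorem Halts.mono (h : Halts p s T₁ Q) (hT : T₁ ≤ T₂) (hQ : ∀ s', Q s' → Q' s') :
    Halts p s T₂ Q' := by
  obtain ⟨t, s', hr, ht, hs⟩ := h
  exact ⟨t, s', hr, ht.trans hT, hQ s' hs⟩

theorem Halts.seq (h : Halts p s T₁ fun s' => Halts q s' T₂ Q) :
    Halts (.seq p q) s (T₁ + T₂) Q := by
  obtain ⟨t₁, s₁, hr₁, ht₁, t₂, s₂, hr₂, ht₂, hs⟩ := h
  exact ⟨_, _, .seq hr₁ hr₂, by omega, hs⟩

theorem Halts.ite {b : Test} (h₁ : b.Holds s → Halts p s T Q) (h₂ : ¬ b.Holds s → Halts q s T Q) :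
    Halts (.ite b p q) s (T + 1) Q := by
  by_cases hb : b.Holds s
  · obtain ⟨t, s', hr, ht, hs⟩ := h₁ hb
    exact ⟨_, _, .ite_true hb hr, by omega, hs⟩
  · obtain ⟨t, s', hr, ht, hs⟩ := h₂ hb
    exact ⟨_, _, .ite_false hb hr, by omega, hs⟩

theorem Halts.skip (h : Q s) : Halts .skip s 1 Q := ⟨1, s, .skip s, le_rfl, h⟩

theorem Halts.const {x n : ℕ} (h : Q (s.setReg x n)) : Halts (.const x n) s 1 Q :=
  ⟨1, _, .const s x n, le_rfl, h⟩

theorem Halts.copy {x y : ℕ} (h : Q (s.setReg x (s.reg y))) : Halts (.copy x y) s 1 Q :=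
  ⟨1, _, .copy s x y, le_rfl, h⟩

theorem Halts.inc {x : ℕ} (h : Q (s.setReg x (s.reg x + 1))) : Halts (.inc x) s 1 Q :=
  ⟨1, _, .inc s x, le_rfl, h⟩

theorem Halts.load {x k y : ℕ} (h : Q (s.setReg x (s.arr k (s.reg y)))) :
    Halts (.load x k y) s 1 Q :=
  ⟨1, _, .load s x k y, le_rfl, h⟩

theorem Halts.store {k y x : ℕ} (h : Q (s.setArr k (s.reg y) (s.reg x))) :
    Halts (.store k y x) s 1 Q :=
  ⟨1, _, .store s k y x, le_rfl, h⟩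

/-- A loop whose control register runs from `0` to `N`. The invariant `I j` holds after `j`
rounds. -/
theorem Halts.loop_lt {i n N : ℕ} {I : ℕ → State → Prop}
    (hctrl : ∀ j s, I j s → s.reg i = j ∧ s.reg n = N) (h0 : I 0 s)
    (hbody : ∀ j < N, ∀ s, I j s → Halts p s T (I (j + 1))) :
    Halts (.loop (.lt i n) p) s (N * (T + 1) + 1) (I N) := by
  suffices h : ∀ r j, j + r = N → ∀ s, I j s →
      Halts (.loop (.lt i n) p) s (r * (T + 1) + 1) (I N) from h N 0 (by omega) s h0
  intro r
  induction r with
  | zero =>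
    rintro j rfl s hs
    obtain ⟨h1, h2⟩ := hctrl _ _ hs
    refine ⟨1, s, .loop_false ?_, by omega, hs⟩
    simp only [Test.Holds]
    omega
  | succ r ih =>
    intro j hj s hs
    obtain ⟨h1, h2⟩ := hctrl _ _ hs
    obtain ⟨t₁, s₁, hr₁, ht₁, hs₁⟩ := hbody j (by omega) s hs
    obtain ⟨t₂, s₂, hr₂, ht₂, hs₂⟩ := ih (j + 1) (by omega) s₁ hs₁
    refine ⟨_, s₂, .loop_true ?_ hr₁ hr₂, ?_, hs₂⟩
    · simp only [Test.Holds]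
      omega
    · rw [Nat.succ_mul]
      omega

/-! ### The program -/

/-- Run `h` if triple number `reg 2` is uncovered and contains the point in register `3`. Array `3`
marks the covered triples; register `8` is always zero. -/
def onHit (h : Prog) : Prog :=
  .seq (.load 7 3 2) (.ite (.eq 7 8)
    (.seq (.load 7 0 2) (.ite (.eq 7 3) h
      (.seq (.load 7 1 2) (.ite (.eq 7 3) h
        (.seq (.load 7 2 2) (.ite (.eq 7 3) h .skip))))))
    .skip)

/-- Run `h` for all uncovered triples that contain the point in register `3`. -/
def scan (h : Prog) : Prog :=
  .seq (.const 2 0) (.loop (.lt 2 0) (.seq (onHit h) (.inc 2)))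

/-- The greedy step for the point of index `k` of triple number `reg 1`, with the threshold in
register `5`: count the uncovered triples that contain it; if there are enough of them, append the
point to array `4` and mark these triples. Register `9` is always one. -/
def stepProg (k : ℕ) : Prog :=
  .seq (.load 3 k 1) (.seq (.const 4 0) (.seq (scan (.inc 4))
    (.ite (.le 5 4)
      (.seq (.store 4 6 3) (.seq (.inc 6) (scan (.store 3 2 9))))
      .skip)))

/-- The greedy pass with threshold `d`. -/
def passProg (d : ℕ) : Prog :=
  .seq (.const 5 d) (.seq (.const 1 0) (.loop (.lt 1 0)
    (.seq (stepProg 0) (.seq (stepProg 1) (.seq (stepProg 2) (.inc 1))))))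

/-- Move the output from array `4` and register `6` to its place. -/
def outputProg : Prog :=
  .seq (.const 1 0) (.seq
    (.loop (.lt 1 6) (.seq (.load 3 4 1) (.seq (.store 0 1 3) (.inc 1))))
    (.copy 0 6))

/-- The greedy algorithm. -/
def coverProg : Prog :=
  .seq (.const 9 1) (.seq (passProg 3) (.seq (passProg 2) (.seq (passProg 1) outputProg)))

/-! ### Correctness and running time of the program -/

variable {E : ℕ → ℕ → ℕ} {m d i : ℕ} {S : Finset ℕ × Finset ℕ}

/-- The state represents the pair `S` of uncovered triples and selected points. -/
structure Represents (E : ℕ → ℕ → ℕ) (m d i : ℕ) (S : Finset ℕ × Finset ℕ) (s : State) :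
    Prop where
  size : s.reg 0 = m
  index : s.reg 1 = i
  threshold : s.reg 5 = d
  count : s.reg 6 = #S.2
  zero : s.reg 8 = 0
  one : s.reg 9 = 1
  table : ∀ k < 3, s.arr k = E k
  uncovered : ∀ j < m, s.arr 3 j = 0 ↔ j ∈ S.1
  selected : (range #S.2).image (s.arr 4) = S.2

/-- The other registers hold temporary values. -/
theorem Represents.setReg (h : Represents E m d i S s) {x n : ℕ}
    (hx : x = 2 ∨ x = 3 ∨ x = 4 ∨ x = 7) : Represents E m d i S (s.setReg x n) := by
  obtain ⟨h0, h1, h5, h6, h8, h9, ht, hu, hs⟩ := h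
  rcases hx with rfl | rfl | rfl | rfl <;>
    exact ⟨by simpa [State.setReg], by simpa [State.setReg], by simpa [State.setReg],
      by simpa [State.setReg], by simpa [State.setReg], by simpa [State.setReg], ht, hu, hs⟩

theorem setReg_reg_self (s : State) (x n : ℕ) : (s.setReg x n).reg x = n := by
  simp [State.setReg]

theorem setReg_reg_of_ne (s : State) {x y : ℕ} (n : ℕ) (h : y ≠ x) :
    (s.setReg x n).reg y = s.reg y := by
  simp [State.setReg, h]

theorem setReg_setReg (s : State) (x n n' : ℕ) :
    (s.setReg x n).setReg x n' = s.setReg x n' := by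
  simp [State.setReg]

theorem setReg_arr (s : State) (x n : ℕ) : (s.setReg x n).arr = s.arr := rfl

theorem setArr_arr_self (s : State) (k y n : ℕ) :
    (s.setArr k y n).arr k = Function.update (s.arr k) y n := by
  simp [State.setArr]

theorem setArr_arr_of_ne (s : State) {k k' : ℕ} (y n : ℕ) (h : k' ≠ k) :
    (s.setArr k y n).arr k' = s.arr k' := by
  simp [State.setArr, h]

/-- Only register `7` is overwritten before `h` runs; the whole block takes at most nine time units
when `h` takes one. -/
theorem halts_onHit {h : Prog} {j x : ℕ} (hs : Represents E m d i S s) (hj : j < m)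
    (h2 : s.reg 2 = j) (h3 : s.reg 3 = x)
    (hyes : ∀ n, j ∈ S.1 ∧ InTriple E x j → Halts h (s.setReg 7 n) 1 Q)
    (hno : ∀ n, ¬ (j ∈ S.1 ∧ InTriple E x j) → Q (s.setReg 7 n)) :
    Halts (onHit h) s 9 Q := by
  have hE : ∀ k < 3, s.arr k j = E k j := fun k hk => by rw [hs.table k hk]
  have hu := hs.uncovered j hj
  refine (Halts.seq (T₁ := 1) (T₂ := 8) (.load (.ite (T := 7) (fun hb => ?_) fun hb => ?_)))
  · have hjS : j ∈ S.1 := by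
      simpa [Test.Holds, State.setReg, h2, hs.zero, hu] using hb
    refine Halts.seq (T₁ := 1) (T₂ := 6) (.load (.ite (T := 5) (fun hb₀ => ?_) fun hb₀ => ?_))
    · rw [setReg_setReg]
      refine (hyes _ ⟨hjS, Or.inl ?_⟩).mono (by omega) fun _ => id
      simpa [Test.Holds, State.setReg, h2, h3, hE] using hb₀
    refine Halts.seq (T₁ := 1) (T₂ := 4) (.load (.ite (T := 3) (fun hb₁ => ?_) fun hb₁ => ?_))
    · rw [setReg_setReg, setReg_setReg]
      refine (hyes _ ⟨hjS, Or.inr (Or.inl ?_)⟩).mono (by omega) fun _ => id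
      simpa [Test.Holds, State.setReg, h2, h3, hE] using hb₁
    refine Halts.seq (T₁ := 1) (T₂ := 2) (.load (.ite (T := 1) (fun hb₂ => ?_) fun hb₂ => ?_))
    · rw [setReg_setReg, setReg_setReg, setReg_setReg]
      refine hyes _ ⟨hjS, Or.inr (Or.inr ?_)⟩
      simpa [Test.Holds, State.setReg, h2, h3, hE] using hb₂
    · rw [setReg_setReg, setReg_setReg, setReg_setReg]
      refine .skip (hno _ ?_)
      rintro ⟨-, h | h | h⟩
      · exact hb₀ (by simpa [Test.Holds, State.setReg, h2, h3, hE] using h)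
      · exact hb₁ (by simpa [Test.Holds, State.setReg, h2, h3, hE] using h)
      · exact hb₂ (by simpa [Test.Holds, State.setReg, h2, h3, hE] using h)
  · refine (Halts.skip (hno _ fun h => hb ?_)).mono (by omega) fun _ => id
    simpa [Test.Holds, State.setReg, h2, hs.zero, hu] using h.1

/-- The invariant `I j` describes the state in which the triples below `j` are done. -/
theorem halts_scan {h : Prog} {x : ℕ} {A : ℕ → Finset ℕ × Finset ℕ} {I : ℕ → State → Prop}
    (hI : ∀ j s, I j s → Represents E m d i (A j) s ∧ s.reg 2 = j ∧ s.reg 3 = x)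
    (h0 : I 0 (s.setReg 2 0))
    (hyes : ∀ j < m, ∀ s, I j s → ∀ n, j ∈ (A j).1 ∧ InTriple E x j →
      Halts h (s.setReg 7 n) 1 fun s' => I (j + 1) (s'.setReg 2 (s'.reg 2 + 1)))
    (hno : ∀ j < m, ∀ s, I j s → ∀ n, ¬ (j ∈ (A j).1 ∧ InTriple E x j) →
      I (j + 1) ((s.setReg 7 n).setReg 2 (j + 1))) :
    Halts (scan h) s (11 * m + 2) (I m) := by
  have hloop := Halts.loop_lt (p := .seq (onHit h) (.inc 2)) (T := 10) (i := 2) (n := 0) (N := m)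
    (fun j s hs => ⟨(hI j s hs).2.1, (hI j s hs).1.size⟩) h0 (by
      intro j hj s hs
      obtain ⟨hr, h2, h3⟩ := hI j s hs
      refine Halts.seq (T₁ := 9) (T₂ := 1) (halts_onHit hr hj h2 h3 (fun n hn => ?_) fun n hn => ?_)
      · exact (hyes j hj s hs n hn).mono le_rfl fun _ => .inc
      · refine .inc ?_
        rw [setReg_reg_of_ne _ _ (by simp), h2]
        exact hno j hj s hs n hn)
  exact (Halts.seq (.const hloop)).mono (by omega) fun _ => id

theorem halts_scan_count {x : ℕ} (hs : Represents E m d i S s) (hS : S.1 ⊆ range m)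
    (h3 : s.reg 3 = x) (h4 : s.reg 4 = 0) :
    Halts (scan (.inc 4)) s (11 * m + 2) fun s' => Represents E m d i S s' ∧
      s'.reg 3 = x ∧ s'.reg 4 = #{j ∈ S.1 | InTriple E x j} := by
  refine (halts_scan (E := E) (m := m) (d := d) (i := i) (x := x) (A := fun _ => S)
    (I := fun j s' => Represents E m d i S s' ∧ s'.reg 2 = j ∧ s'.reg 3 = x ∧
      s'.reg 4 = #{a ∈ S.1 | a < j ∧ InTriple E x a})
    (fun j s' h => ⟨h.1, h.2.1, h.2.2.1⟩) ?_ ?_ ?_).mono le_rfl ?_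
  · exact ⟨hs.setReg (by simp), by simp [State.setReg], by simpa [State.setReg],
      by simpa [State.setReg]⟩
  · rintro j hj s ⟨hr, h2, h3, h4⟩ n ⟨hjS, hjx⟩
    refine .inc ⟨((hr.setReg (by simp)).setReg (by simp)).setReg (by simp), ?_, ?_, ?_⟩
    · simp [State.setReg, h2]
    · simp [State.setReg, h3]
    · have : ({a ∈ S.1 | a < j + 1 ∧ InTriple E x a} : Finset ℕ) =
          insert j {a ∈ S.1 | a < j ∧ InTriple E x a} := by
        ext a
        simp only [mem_filter, mem_insert, Nat.lt_succ_iff_lt_or_eq]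
        constructor
        · tauto
        · rintro (rfl | h)
          · exact ⟨hjS, Or.inr rfl, hjx⟩
          · tauto
      rw [this, card_insert_of_notMem (by simp), ← h4]
      simp [State.setReg]
  · rintro j hj s ⟨hr, h2, h3, h4⟩ n hn
    refine ⟨(hr.setReg (by simp)).setReg (by simp), ?_, ?_, ?_⟩
    · simp [State.setReg]
    · simp [State.setReg, h3]
    · have : ({a ∈ S.1 | a < j + 1 ∧ InTriple E x a} : Finset ℕ) =
          {a ∈ S.1 | a < j ∧ InTriple E x a} := by
        refine filter_congr fun a ha => ?_
        rw [Nat.lt_succ_iff_lt_or_eq]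
        constructor
        · rintro ⟨h | rfl, hx⟩
          · exact ⟨h, hx⟩
          · exact absurd ⟨ha, hx⟩ hn
        · tauto
      rw [this, ← h4]
      simp [State.setReg]
  · rintro s' ⟨hr, -, h3, h4⟩
    refine ⟨hr, h3, h4.trans (congrArg card (filter_congr fun a ha => ?_))⟩
    simp [mem_range.1 (hS ha)]

theorem halts_scan_mark {x : ℕ} (hs : Represents E m d i S s) (hS : S.1 ⊆ range m)
    (h3 : s.reg 3 = x) :
    Halts (scan (.store 3 2 9)) s (11 * m + 2)
      (Represents E m d i ({j ∈ S.1 | ¬ InTriple E x j}, S.2)) := by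
  refine (halts_scan (E := E) (m := m) (d := d) (i := i) (x := x)
    (A := fun j => ({a ∈ S.1 | ¬ (a < j ∧ InTriple E x a)}, S.2))
    (I := fun j s' => Represents E m d i ({a ∈ S.1 | ¬ (a < j ∧ InTriple E x a)}, S.2) s' ∧
      s'.reg 2 = j ∧ s'.reg 3 = x)
    (fun j s' h => h) ?_ ?_ ?_).mono le_rfl ?_
  · refine ⟨?_, by simp [State.setReg], by simpa [State.setReg]⟩
    simpa using hs.setReg (by simp)
  · rintro j hj s ⟨hr, h2, h3⟩ n ⟨hjS, hjx⟩
    refine .store ⟨?_, by simp [State.setReg, State.setArr, h2],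
      by simp [State.setReg, State.setArr, h3]⟩
    refine Represents.setReg ?_ (by simp)
    have hr' := hr.setReg (x := 7) (n := n) (by simp)
    refine ⟨hr'.size, hr'.index, hr'.threshold, hr'.count, hr'.zero, hr'.one, fun k hk => ?_,
      fun a ha => ?_, ?_⟩
    · rw [setArr_arr_of_ne _ _ _ (by omega)]
      exact hr'.table k hk
    · have hu := hr'.uncovered a ha
      rw [setArr_arr_self, setReg_reg_of_ne _ _ (by simp), h2, hr'.one]
      rcases eq_or_ne a j with rfl | haj
      · rw [Function.update_self]
        exact iff_of_false one_ne_zero fun h => (mem_filter.1 h).2 ⟨a.lt_succ_self, hjx⟩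
      · rw [Function.update_of_ne haj, hu]
        simp only [mem_filter, Nat.lt_succ_iff_lt_or_eq, haj, or_false]
    · rw [setArr_arr_of_ne _ _ _ (by simp)]
      exact hr'.selected
  · rintro j hj s ⟨hr, h2, h3⟩ n hn
    refine ⟨?_, by simp [State.setReg], by simpa [State.setReg]⟩
    have : ({a ∈ S.1 | ¬ (a < j + 1 ∧ InTriple E x a)} : Finset ℕ) =
        {a ∈ S.1 | ¬ (a < j ∧ InTriple E x a)} := by
      refine filter_congr fun a ha => not_congr ?_
      rw [Nat.lt_succ_iff_lt_or_eq]
      constructor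
      · rintro ⟨h | rfl, hx⟩
        · exact ⟨h, hx⟩
        · exact absurd ⟨mem_filter.2 ⟨ha, by simp⟩, hx⟩ hn
      · tauto
    rw [this]
    exact (hr.setReg (by simp)).setReg (by simp)
  · rintro s' ⟨hr, -, -⟩
    have : ({a ∈ S.1 | ¬ (a < m ∧ InTriple E x a)} : Finset ℕ) =
        {j ∈ S.1 | ¬ InTriple E x j} :=
      filter_congr fun a ha => by simp [mem_range.1 (hS ha)]
    rwa [this] at hr

/-- A point that is selected is new, because it lies in an uncovered triple; hence the counter in
register `6` remains the number of selected points. -/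
theorem halts_stepProg {k : ℕ} (hk : k < 3) (hd : 0 < d) (hs : Represents E m d i S s)
    (hS : IsPartialCover E m S) :
    Halts (stepProg k) s (22 * m + 9)
      (Represents E m d i (greedyStep E d (E k i) S)) := by
  set x := E k i with hx
  have h3 : s.arr k (s.reg 1) = x := by rw [hs.table k hk, hs.index]
  refine (Halts.seq (T₁ := 1) (T₂ := 22 * m + 8) (.load ?_)).mono (by omega) fun _ => id
  refine (Halts.seq (T₁ := 1) (T₂ := 22 * m + 7) (.const ?_)).mono (by omega) fun _ => id
  refine (Halts.seq (T₁ := 11 * m + 2) (T₂ := 11 * m + 5) ?_).mono (by omega) fun _ => id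
  refine (halts_scan_count (x := x) ((hs.setReg (by simp)).setReg (by simp)) hS.subset
    (by simp [State.setReg, h3]) (by simp [State.setReg])).mono le_rfl ?_
  rintro s' ⟨hr, h3, h4⟩
  refine Halts.ite (T := 11 * m + 4) (fun hb => ?_) fun hb => ?_
  · have hle : d ≤ #{j ∈ S.1 | InTriple E x j} := by
      simpa [Test.Holds, hr.threshold, h4] using hb
    have hxS : x ∉ S.2 := by
      intro hxS
      obtain ⟨j, hj⟩ := card_pos.1 (hd.trans_le hle)
      rw [mem_filter] at hj
      exact hS.fresh x hxS j hj.1 hj.2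
    refine (Halts.seq (T₁ := 1) (T₂ := 11 * m + 3) (.store ?_)).mono (by omega) fun _ => id
    refine (Halts.seq (T₁ := 1) (T₂ := 11 * m + 2) (.inc ?_)).mono (by omega) fun _ => id
    rw [greedyStep, if_pos hle]
    refine halts_scan_mark (S := (S.1, insert x S.2)) ?_ hS.subset
      (by simp [State.setReg, State.setArr, h3])
    refine ⟨?_, ?_, ?_, ?_, ?_, ?_, ?_, ?_, ?_⟩
    · simpa [State.setReg, State.setArr] using hr.size
    · simpa [State.setReg, State.setArr] using hr.index
    · simpa [State.setReg, State.setArr] using hr.threshold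
    · simpa [State.setReg, State.setArr, card_insert_of_notMem hxS] using hr.count
    · simpa [State.setReg, State.setArr] using hr.zero
    · simpa [State.setReg, State.setArr] using hr.one
    · intro k' hk'
      rw [setReg_arr, setArr_arr_of_ne _ _ _ (by omega)]
      exact hr.table k' hk'
    · intro j hj
      rw [setReg_arr, setArr_arr_of_ne _ _ _ (by simp)]
      exact hr.uncovered j hj
    · rw [setReg_arr, setArr_arr_self, hr.count, h3]
      dsimp only
      rw [card_insert_of_notMem hxS, range_add_one, image_insert, Function.update_self]
      congr 1
      refine Eq.trans (image_congr fun a ha => ?_) hr.selected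
      exact Function.update_of_ne (mem_range.1 (mem_coe.1 ha)).ne _ _
  · have hlt : ¬ d ≤ #{j ∈ S.1 | InTriple E x j} := by
      simpa [Test.Holds, hr.threshold, h4] using hb
    rw [greedyStep, if_neg hlt]
    exact (Halts.skip hr).mono (by omega) fun _ => id

theorem halts_passProg {d' : ℕ} (hd : 0 < d) (hs : Represents E m d' i S s)
    (hS : IsPartialCover E m S) :
    Halts (passProg d) s (m * (66 * m + 29) + 3)
      (Represents E m d m (greedyPass E d m S)) := by
  have hinit : Represents E m d 0 S ((s.setReg 5 d).setReg 1 0) := by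
    obtain ⟨h0, h1, h5, h6, h8, h9, ht, hu, hsel⟩ := hs
    exact ⟨by simpa [State.setReg], by simp [State.setReg], by simp [State.setReg],
      by simpa [State.setReg], by simpa [State.setReg], by simpa [State.setReg], ht, hu, hsel⟩
  have hloop := Halts.loop_lt (i := 1) (n := 0) (N := m) (T := 66 * m + 28)
    (p := .seq (stepProg 0) (.seq (stepProg 1) (.seq (stepProg 2) (.inc 1))))
    (I := fun i s' => Represents E m d i (greedyPass E d i S) s')
    (fun i s' h => ⟨h.index, h.size⟩) hinit (by
      intro i _ s hs
      have hS₀ := hS.greedyPass hd i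
      have hS₁ := hS₀.greedyStep hd (E 0 i)
      refine (Halts.seq ((halts_stepProg (by simp) hd hs hS₀).mono le_rfl fun s₁ hs₁ =>
        Halts.seq ((halts_stepProg (by simp) hd hs₁ hS₁).mono le_rfl fun s₂ hs₂ =>
        Halts.seq ((halts_stepProg (by simp) hd hs₂ (hS₁.greedyStep hd (E 1 i))).mono le_rfl
        fun s₃ hs₃ => .inc ?_)))).mono (by omega) fun _ => id
      obtain ⟨h0, h1, h5, h6, h8, h9, ht, hu, hsel⟩ := hs₃
      exact ⟨by simpa [State.setReg], by simpa [State.setReg], by simpa [State.setReg],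
        by simpa [State.setReg], by simpa [State.setReg], by simpa [State.setReg], ht, hu, hsel⟩)
  exact (Halts.seq (.const (Halts.seq (.const hloop)))).mono (le_of_eq (by ring)) fun _ => id

theorem halts_outputProg (hs : Represents E m d i S s) :
    Halts outputProg s (4 * #S.2 + 3) fun s' =>
      s'.reg 0 = #S.2 ∧ (range #S.2).image (s'.arr 0) = S.2 := by
  have hloop := Halts.loop_lt (s := s.setReg 1 0) (i := 1) (n := 6) (N := #S.2) (T := 3)
    (p := .seq (.load 3 4 1) (.seq (.store 0 1 3) (.inc 1)))
    (I := fun j s' => s'.reg 1 = j ∧ s'.reg 6 = #S.2 ∧ s'.arr 4 = s.arr 4 ∧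
      ∀ a < j, s'.arr 0 a = s.arr 4 a)
    (fun j s' h => ⟨h.1, h.2.1⟩)
    ⟨by simp [State.setReg], by simp [State.setReg, hs.count], rfl, by simp⟩ (by
      rintro j - s' ⟨h1, h6, h4, h0⟩
      refine Halts.seq (T₁ := 1) (T₂ := 2) (.load (Halts.seq (T₁ := 1) (T₂ := 1)
        (.store (.inc ⟨?_, ?_, ?_, ?_⟩))))
      · simp [State.setReg, State.setArr, h1]
      · simp [State.setReg, State.setArr, h6]
      · rw [setReg_arr, setArr_arr_of_ne _ _ _ (by simp)]
        exact h4
      · intro a ha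
        rw [setReg_arr, setArr_arr_self, setReg_reg_of_ne _ _ (by simp), setReg_reg_self, h1, h4]
        rcases Nat.lt_succ_iff_lt_or_eq.1 ha with ha | rfl
        · rw [Function.update_of_ne ha.ne]
          exact h0 a ha
        · rw [Function.update_self])
  refine (Halts.seq (.const (Halts.seq (hloop.mono le_rfl fun s' hs' => .copy ?_)))).mono
    (by omega) fun _ => id
  obtain ⟨-, h6, -, h0⟩ := hs'
  refine ⟨by simpa [State.setReg] using h6, ?_⟩
  refine Eq.trans (image_congr fun a ha => ?_) hs.selected
  exact h0 a (mem_range.1 (mem_coe.1 ha))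

theorem halts_coverProg (hm : 0 < m) (h0 : s.reg 0 = m) (hreg : ∀ x, x ≠ 0 → s.reg x = 0)
    (htable : ∀ k < 3, s.arr k = E k) (h3 : s.arr 3 = 0) :
    Halts coverProg s (302 * m ^ 3) fun s' =>
      s'.reg 0 = #(greedyCover E m).2 ∧
        (range #(greedyCover E m).2).image (s'.arr 0) = (greedyCover E m).2 := by
  have hinit : Represents E m 0 0 (range m, ∅) (s.setReg 9 1) :=
    ⟨by simpa [State.setReg], by simp [State.setReg, hreg], by simp [State.setReg, hreg],
      by simp [State.setReg, hreg], by simp [State.setReg, hreg], by simp [State.setReg], htable,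
      fun j hj => by simp [State.setReg, h3, hj], by simp⟩
  have hS₀ : IsPartialCover E m (range m, ∅) := isPartialCover_init
  have hS₁ := hS₀.greedyPass (d := 3) (by simp) m
  have hS₂ := hS₁.greedyPass (d := 2) (by simp) m
  refine (Halts.seq (.const (Halts.seq ((halts_passProg (by simp) hinit hS₀).mono le_rfl
    fun s₁ hs₁ => Halts.seq ((halts_passProg (by simp) hs₁ hS₁).mono le_rfl
    fun s₂ hs₂ => Halts.seq ((halts_passProg (by simp) hs₂ hS₂).mono le_rfl
    fun s₃ hs₃ => halts_outputProg hs₃)))))).mono ?_ fun _ => id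
  have hle : #(greedyPass E 1 m (greedyPass E 2 m (greedyPass E 3 m (range m, ∅)))).2 ≤ m :=
    card_greedyCover_le
  nlinarith [Nat.pow_le_pow_right hm (show 1 ≤ 3 by simp),
    Nat.pow_le_pow_right hm (show 2 ≤ 3 by simp)]

end Machine

/-! ### Triangles of a graph -/

section Triangles

open Classical

variable {V : Type u} [Fintype V] {G : SimpleGraph V}

theorem mem_triangles {T : Finset (Sym2 V)} : T ∈ triangles G ↔ IsTriangle G T := by
  simp [triangles]

theorem subset_edgeSet_of_mem_triangles {T : Finset (Sym2 V)} (hT : T ∈ triangles G) :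
    (T : Set (Sym2 V)) ⊆ G.edgeSet := by
  obtain ⟨a, b, c, hab, hbc, hac, h⟩ := mem_triangles.1 hT
  rw [h]
  rintro e (rfl | rfl | rfl)
  · exact hab
  · exact hbc
  · exact hac

theorem card_le_packingNumber {P : Finset (Finset (Sym2 V))} (hP : IsTrianglePacking G P) :
    #P ≤ packingNumber G := by
  refine le_csSup ⟨#(triangles G), ?_⟩ ⟨P, hP, rfl⟩
  rintro k ⟨P', hP', rfl⟩
  exact card_le_card hP'.1

theorem coveringNumber_le {C : Finset (Sym2 V)} (hC : IsTriangleCover G C) :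
    coveringNumber G ≤ #C :=
  Nat.sInf_le ⟨C, hC, rfl⟩

theorem nonempty_triangleListing (G : SimpleGraph V) : Nonempty (TriangleListing G) := by
  have h : ∀ T : {T : Finset (Sym2 V) // T ∈ triangles G}, ∃ f : Fin 3 → Sym2 V,
      Set.range f = (T : Finset (Sym2 V)) := by
    rintro ⟨T, hT⟩
    obtain ⟨a, b, c, -, -, -, h⟩ := mem_triangles.1 hT
    refine ⟨![s(a, c), s(b, c), s(a, b)], ?_⟩
    rw [h]
    ext e
    simp only [Matrix.range_cons, Matrix.range_empty, Set.mem_union, Set.mem_singleton_iff,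
      Set.mem_insert_iff, Set.mem_empty_iff_false]
    tauto
  choose f hf using h
  exact ⟨(triangles G).equivFin.symm, fun i => f ((triangles G).equivFin.symm i), fun i => hf _⟩

variable (name : Sym2 V → ℕ) (L : TriangleListing G)

theorem inputState_arr (i : Fin #(triangles G)) (k : Fin 3) :
    (inputState name L).arr k i = name (L.edge i k) := by
  simp [inputState]

variable {name L}

theorem inTriple_inputState_iff {x : ℕ} {i : Fin #(triangles G)} :
    InTriple (inputState name L).arr x i ↔
      ∃ e ∈ (L.tri i : Finset (Sym2 V)), name e = x := by
  have h0 := inputState_arr name L i 0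
  have h1 := inputState_arr name L i 1
  have h2 := inputState_arr name L i 2
  have hr := L.range_edge i
  simp only [Fin.val_zero, Fin.val_one, Fin.val_two] at h0 h1 h2
  rw [InTriple, h0, h1, h2]
  simp only [← mem_coe, ← hr, Set.exists_range_iff, Fin.exists_fin_succ]
  simp

/-- Independent sets of the conflict graph are packings. -/
theorem card_le_packingNumber_of_isIndepSet {I : Finset ℕ} (hI : I ⊆ range #(triangles G))
    (hind : (conflictGraph (inputState name L).arr).IsIndepSet (I : Set ℕ)) :
    #I ≤ packingNumber G := by
  let J : Finset (Fin #(triangles G)) := univ.filter fun i => (i : ℕ) ∈ I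
  let t : Fin #(triangles G) → Finset (Sym2 V) := fun i => L.tri i
  have ht : Function.Injective t := Subtype.val_injective.comp L.tri.injective
  have hIJ : I = J.image Fin.val := by
    ext i
    simp only [J, mem_image, mem_filter, mem_univ, true_and]
    exact ⟨fun hi => ⟨⟨i, mem_range.1 (hI hi)⟩, hi, rfl⟩, fun ⟨j, hj, hji⟩ => hji ▸ hj⟩
  rw [hIJ, card_image_of_injective _ Fin.val_injective, ← card_image_of_injective J ht]
  refine card_le_packingNumber ⟨?_, ?_⟩
  · intro T hT
    obtain ⟨i, -, rfl⟩ := mem_image.1 hT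
    exact (L.tri i).2
  · intro S hS T hT hne
    obtain ⟨i, hi, rfl⟩ := mem_image.1 hS
    obtain ⟨j, hj, rfl⟩ := mem_image.1 hT
    have hij : i ≠ j := fun h => hne (by rw [h])
    rw [disjoint_left]
    intro e hei hej
    exact hind (mem_filter.1 hi).2 (mem_filter.1 hj).2 (Fin.val_injective.ne hij)
      ⟨Fin.val_injective.ne hij, name e, inTriple_inputState_iff.2 ⟨e, hei, rfl⟩,
        inTriple_inputState_iff.2 ⟨e, hej, rfl⟩⟩

/-- The set of edges whose names the program outputs. -/
theorem exists_isTriangleCover_image_eq (hname : Set.InjOn name G.edgeSet) :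
    ∃ C, IsTriangleCover G C ∧
      C.image name = (greedyCover (inputState name L).arr #(triangles G)).2 ∧
      #C = #(greedyCover (inputState name L).arr #(triangles G)).2 := by
  set X := (greedyCover (inputState name L).arr #(triangles G)).2 with hX
  let C : Finset (Sym2 V) := univ.filter fun e => e ∈ G.edgeSet ∧ name e ∈ X
  have hC : (C : Set (Sym2 V)) ⊆ G.edgeSet := fun e he => (mem_filter.1 (mem_coe.1 he)).2.1
  have hCX : C.image name = X := by
    ext x
    simp only [C, mem_image, mem_filter, mem_univ, true_and]
    constructor
    · rintro ⟨e, ⟨-, he⟩, rfl⟩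
      exact he
    · intro hx
      obtain ⟨i, hi, hxi⟩ := greedyCover_isPartialCover.exists_inTriple x hx
      obtain ⟨e, he, rfl⟩ := (inTriple_inputState_iff (i := ⟨i, hi⟩)).1 hxi
      exact ⟨e, ⟨subset_edgeSet_of_mem_triangles (L.tri ⟨i, hi⟩).2 he, hx⟩, rfl⟩
  refine ⟨C, ⟨hC, fun T hT => ?_⟩, hCX, ?_⟩
  · obtain ⟨i, hi⟩ := L.tri.surjective ⟨T, hT⟩
    obtain ⟨x, hx, hxi⟩ := greedyCover_covers (E := (inputState name L).arr) i.2
    obtain ⟨e, he, rfl⟩ := inTriple_inputState_iff.1 hxi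
    rw [hi] at he
    exact ⟨e, he, mem_filter.2 ⟨mem_univ _, subset_edgeSet_of_mem_triangles hT he, hx⟩⟩
  · rw [← hCX, card_image_of_injOn (hname.mono hC)]

/-- `m / 3 + ν ≤ (3 c + 1) / (3 c) ν` when `c m ≤ ν`. -/
theorem le_ratio_mul {c x m ν : ℝ} (hc : 0 < c) (hm : 0 < m) (hcm : c ≤ ν / m)
    (hx : 3 * x ≤ m + 3 * ν) : x ≤ (3 * c + 1) / (3 * c) * ν := by
  rw [le_div_iff₀ hm] at hcm
  rw [div_mul_eq_mul_div, le_div_iff₀ (by positivity)]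
  nlinarith

/-- Without triangles the quotient is `0 / 0 = 0`, so the hypothesis on `c` excludes this case. -/
theorem card_triangles_pos {c : ℝ} (hc : 0 < c)
    (h : c ≤ (packingNumber G : ℝ) / (#(triangles G) : ℝ)) : 0 < #(triangles G) := by
  rw [Nat.pos_iff_ne_zero]
  intro h0
  rw [h0, Nat.cast_zero, div_zero] at h
  exact absurd h (not_le.2 hc)

theorem run_coverProg {c : ℝ} (hc : 0 < c)
    (h : c ≤ (packingNumber G : ℝ) / (#(triangles G) : ℝ))
    (hname : Set.InjOn name G.edgeSet) :
    ∃ t s C, Run coverProg (inputState name L) t s ∧ t ≤ 302 * #(triangles G) ^ 3 ∧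
      HoldsOutput name C s ∧ IsTriangleCover G C ∧
      (#C : ℝ) ≤ (3 * c + 1) / (3 * c) * (packingNumber G : ℝ) := by
  have hm := card_triangles_pos hc h
  obtain ⟨C, hC, himage, hcard⟩ := exists_isTriangleCover_image_eq (L := L) hname
  obtain ⟨t, s, hrun, ht, h0, hs⟩ := halts_coverProg (s := inputState name L)
    (E := (inputState name L).arr) hm (by simp [inputState])
    (fun x hx => by simp [inputState, hx]) (fun _ _ => rfl) (by ext; simp [inputState])
  refine ⟨t, s, C, hrun, ht, ⟨h0.trans hcard.symm, ?_⟩, hC, ?_⟩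
  · rw [hcard, hs, himage]
  · obtain ⟨I, hI, hind, hle⟩ :=
      exists_isIndepSet_greedyCover (E := (inputState name L).arr) (m := #(triangles G))
    have hν := card_le_packingNumber_of_isIndepSet hI hind
    refine le_ratio_mul hc (Nat.cast_pos.2 hm) h ?_
    rw [← hcard] at hle
    exact_mod_cast hle.trans (by omega)

theorem coveringNumber_div_packingNumber_le (G : SimpleGraph V) {c : ℝ} (hc : 0 < c)
    (h : c ≤ (packingNumber G : ℝ) / (#(triangles G) : ℝ)) :
    (coveringNumber G : ℝ) / (packingNumber G : ℝ) ≤ (3 * c + 1) / (3 * c) := by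
  obtain ⟨L⟩ := nonempty_triangleListing G
  let name : Sym2 V → ℕ := fun e => Fintype.equivFin (Sym2 V) e
  have hname : Function.Injective name :=
    Fin.val_injective.comp (Fintype.equivFin (Sym2 V)).injective
  obtain ⟨-, -, C, -, -, -, hC, hle⟩ := run_coverProg (L := L) hc h hname.injOn
  have hcov : (coveringNumber G : ℝ) ≤ #C := Nat.cast_le.2 (coveringNumber_le hC)
  exact div_le_of_le_mul₀ (by positivity) (by positivity) (hcov.trans hle)

end Triangles

end TriangleCover

theorem theoremc :
    -- one program and one constant serve all graphs and all `c`
    (∃ (P : TriangleCover.Prog) (K : ℕ),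
      ∀ (V : Type u) [Fintype V] (G : SimpleGraph V) (c : ℝ), 0 < c → c ≤ 1 →
        c ≤ (TriangleCover.packingNumber G : ℝ) / ((TriangleCover.triangles G).card : ℝ) →
        ∀ (name : Sym2 V → ℕ), Set.InjOn name G.edgeSet →
        ∀ L : TriangleCover.TriangleListing G,
          ∃ (t : ℕ) (s : TriangleCover.State) (C : Finset (Sym2 V)),
            TriangleCover.Run P (TriangleCover.inputState name L) t s ∧
            t ≤ K * (TriangleCover.triangles G).card ^ 3 ∧
            TriangleCover.HoldsOutput name C s ∧
            TriangleCover.IsTriangleCover G C ∧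
            (C.card : ℝ) ≤ (3 * c + 1) / (3 * c) * (TriangleCover.packingNumber G : ℝ)) ∧
    (∀ (V : Type u) [Fintype V] (G : SimpleGraph V) (c : ℝ), 0 < c → c ≤ 1 →
        c ≤ (TriangleCover.packingNumber G : ℝ) / ((TriangleCover.triangles G).card : ℝ) →
        (TriangleCover.coveringNumber G : ℝ) / (TriangleCover.packingNumber G : ℝ)
          ≤ (3 * c + 1) / (3 * c)) ∧
    (∀ (V : Type u) [Fintype V] (G : SimpleGraph V),
        1 / 3 ≤ (TriangleCover.packingNumber G : ℝ) / ((TriangleCover.triangles G).card : ℝ) →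
        (TriangleCover.coveringNumber G : ℝ) / (TriangleCover.packingNumber G : ℝ) ≤ 2) := by
  refine ⟨⟨TriangleCover.coverProg, 302, ?_⟩, ?_, ?_⟩
  · intro V _ G c hc _ h name hname L
    exact TriangleCover.run_coverProg hc h hname
  · intro V _ G c hc _ h
    exact TriangleCover.coveringNumber_div_packingNumber_le G hc h
  · intro V _ G h
    refine (TriangleCover.coveringNumber_div_packingNumber_le G (by norm_num) h).trans ?_
    norm_num
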